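/- **Setting.** Let $U\subseteq\mathbb C^2$ be open with coordinates $(x,y)$, and let $r\ge 2$, $p\ge 1$, $q\ge 0$ be integers. Put $p_1=p-1$, $p_2=p$, let $$\mathcal S^r_{n,q}=\operatorname{span}_{\mathbb C}\{x^iy^j : i,j\ge 0,\ i+rj\le n,\ j\le q\},$$ and let $\mathbf S=\mathcal S^r_{p-1,q}\oplus\mathcal S^r_{p,q}$, regarded as a space of pairs of functions on $U$. Let $\mathfrak D$ be the associative algebra of $2\times2$ matrix differential operators $T=(T_{ab})$, $T_{ab}=\sum f_{st}(x,y)\partial_x^s\partial_y^t$ (finite sums), with complex-smooth (holomorphic) coefficients on $U$; let $\mathfrak S\subseteq\mathfrak D$ be the operators preserving $\mathbf S$ and $\ker\pi\subseteq\mathfrak S$ those annihilating $\mathbf S$. The distinguished complement $\tilde{\mathfrak S}$ of $\ker\pi$ in $\mathfrak S$ consists of the $T\in\mathfrak S$ such that each $T_{ab}$ involves only derivatives $\partial_x^s\partial_y^t$ with $s+rt\le p_b$ and $t\le q$. An operator has nonpositive $y$-degree if each of its entries maps every monomial $x^iy^j$ to a linear combination of monomials $x^{i'}y^{j'}$ with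 $j'\le j$. For $c\in\mathbb C$ let $J^1=\partial_x$, $J^2_c=x^2\partial_x+rxy\partial_y-cx$, $J^3_c=x\partial_x-\tfrac c2$, $J^4=y\partial_y$, and $J^{5+i}=x^i\partial_y$ for $0\le i\le r$. Let $\sigma^+=\begin{pmatrix}0&1\\0&0\end{pmatrix}$ and $\sigma^-=\begin{pmatrix}0&0\\1&0\end{pmatrix}$. The Lie superalgebra $\mathfrak s^r_p$ is spanned by the $10+2r$ generators $$T^i=\operatorname{diag}(J^i_{p-1},J^i_p)\ (1\le i\le 5+r),\qquad J=\tfrac12\operatorname{diag}(p+1,p),$$ $$Q^-_0=\sigma^-,\quad Q^-_1=x\,\sigma^-,\quad Q^+_0=(x\partial_x+ry\partial_y-p)\,\sigma^+,\quad Q^+_1=\partial_x\,\sigma^+,\quad Q^+_{2+\alpha}=x^\alpha\partial_y\,\sigma^+\ (0\le\alpha\le r-1).$$ A polynomial of degree at most $d$ in the generators is a complex linear combination of products of at most $d$ generators, in any order, the empty product being the identity. **Theorem.** Let $T\in\tilde{\mathfrak S}$ have nonpositive $y$-degree and order at most $k$, where $k\ge 0$. 1. If $k\le q$ and $rk\le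 p-1$, then $T$ is a polynomial of degree at most $k+1$ in the generators of $\mathfrak s^r_p$. (The condition $rk\le p-1$ follows from $k\le q$ when $rq\le p-1$, that is, when monomials with $y$-exponent $q$ do occur in both summands of $\mathbf S$.) 2. In every case, in particular if $k>q$, there is a polynomial $P$ of degree at most $k+1$ in the generators of $\mathfrak s^r_p$ such that $P\in\mathfrak S$ and $T$ is the projection of $P$ onto $\tilde{\mathfrak S}$ along $\ker\pi$, i.e. $P-T\in\ker\pi$. -/

import Mathlib

open scoped ContDiff

noncomputable section

namespace Staircase

open TopologicalSpace

/-- The space `C^∞(U, ℂ)` of complex-smooth (that is, holomorphic) functions of the two complex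
variables `x = z.1`, `y = z.2` on the open set `U`. A function on `U` is represented by its
extension by zero, so that two elements are equal exactly when they agree on `U`. -/
def SmoothFn (U : Opens (ℂ × ℂ)) : Submodule ℂ (ℂ × ℂ → ℂ) where
  carrier := {f | ContDiffOn ℂ ∞ f U ∧ ∀ z, z ∉ U → f z = 0}
  add_mem' := by
    rintro f g ⟨hf, hf'⟩ ⟨hg, hg'⟩
    exact ⟨hf.add hg, fun z hz => by simp [hf' z hz, hg' z hz]⟩
  zero_mem' := ⟨contDiffOn_const, fun _ _ => rfl⟩
  smul_mem' := by
    rintro c f ⟨hf, hf'⟩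
    exact ⟨hf.const_smul c, fun z hz => by simp [hf' z hz]⟩

variable {U : Opens (ℂ × ℂ)}

/-- The restriction to `U` of a function that is smooth on `U`. -/
def restrict (F : ℂ × ℂ → ℂ) (hF : ContDiffOn ℂ ∞ F U) : SmoothFn U :=
  ⟨(U : Set (ℂ × ℂ)).indicator F,
    hF.congr fun _ hz => Set.indicator_of_mem hz F,
    fun _ hz => Set.indicator_of_notMem hz F⟩

/-- The monomial function `x ^ i * y ^ j` on `U`. -/
def mono (U : Opens (ℂ × ℂ)) (i j : ℕ) : SmoothFn U :=
  restrict (fun z => z.1 ^ i * z.2 ^ j)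
    ((contDiff_fst.pow i).mul (contDiff_snd.pow j)).contDiffOn

/-- The `ℂ`-linear operators on `C^∞(U, ℂ)`, an associative algebra under composition. -/
abbrev Op (U : Opens (ℂ × ℂ)) : Type := Module.End ℂ (SmoothFn U)

/-- The operator of multiplication by a smooth function. -/
def mulOp (f : SmoothFn U) : Op U where
  toFun g := ⟨fun z => f.1 z * g.1 z, f.2.1.mul g.2.1, fun z hz => by simp [f.2.2 z hz]⟩
  map_add' g h := by
    ext z
    exact mul_add _ _ _
  map_smul' c g := by
    ext z
    exact mul_left_comm _ _ _

theorem contDiffOn_fderiv_apply (v : ℂ × ℂ) (f : SmoothFn U) :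
    ContDiffOn ℂ ∞ (fun z => fderiv ℂ f.1 z v) U :=
  ((contDiffOn_infty_iff_fderiv_of_isOpen U.isOpen).1 f.2.1).2.clm_apply contDiffOn_const

theorem differentiableAt_of_mem (f : SmoothFn U) {z : ℂ × ℂ} (hz : z ∈ U) :
    DifferentiableAt ℂ f.1 z :=
  (f.2.1.differentiableOn (by simp)).differentiableAt (U.isOpen.mem_nhds hz)

/-- Differentiation in the direction `v`. -/
def derivOp (v : ℂ × ℂ) : Op U where
  toFun f := restrict (fun z => fderiv ℂ f.1 z v) (contDiffOn_fderiv_apply v f)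
  map_add' f g := by
    ext z
    by_cases hz : z ∈ (U : Set (ℂ × ℂ))
    · have h := fderiv_add (differentiableAt_of_mem f hz) (differentiableAt_of_mem g hz)
      simp [restrict, hz, h]
    · simp [restrict, hz]
  map_smul' c f := by
    ext z
    by_cases hz : z ∈ (U : Set (ℂ × ℂ))
    · have h := fderiv_const_smul (differentiableAt_of_mem f hz) c
      simp [restrict, hz, h]
    · simp [restrict, hz]

/-- The operator `∂/∂x`. -/
def dx : Op U := derivOp (1, 0)

/-- The operator `∂/∂y`. -/
def dy : Op U := derivOp (0, 1)

/-- Multiplication by the coordinate `x`. -/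
def X : Op U := mulOp (mono U 1 0)

/-- Multiplication by the coordinate `y`. -/
def Y : Op U := mulOp (mono U 0 1)

/-- The scalar differential operators `∑ f_{st} ∂_x^s ∂_y^t` (finite sums, smooth coefficients)
in which only index pairs `(s, t) ∈ I` occur. -/
def diffOps (U : Opens (ℂ × ℂ)) (I : Set (ℕ × ℕ)) : Submodule ℂ (Op U) :=
  Submodule.span ℂ {D | ∃ (f : SmoothFn U) (s t : ℕ), (s, t) ∈ I ∧ D = mulOp f * dx ^ s * dy ^ t}

/-- The index set (lattice of exponents) `{(i, j) | i + r j ≤ p, j ≤ q}`. -/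
def stairs (r p q : ℕ) : Set (ℕ × ℕ) := {m | m.1 + r * m.2 ≤ p ∧ m.2 ≤ q}

/-- The scalar staircase module spanned by the monomials `x^i y^j`, `i + r j ≤ p`, `j ≤ q`. -/
def scalarModule (U : Opens (ℂ × ℂ)) (r p q : ℕ) : Submodule ℂ (SmoothFn U) :=
  Submodule.span ℂ {g | ∃ i j : ℕ, (i, j) ∈ stairs r p q ∧ g = mono U i j}

/-- `2 × 2` matrices of operators. -/
abbrev MatOp (U : Opens (ℂ × ℂ)) : Type := Matrix (Fin 2) (Fin 2) (Op U)

/-- The action of a matrix of operators on a pair of functions. -/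
def act (T : MatOp U) (v : Fin 2 → SmoothFn U) : Fin 2 → SmoothFn U :=
  fun a => ∑ b, T a b (v b)

/-- The associative algebra of `2 × 2` matrix differential operators. -/
def matDiffOps (U : Opens (ℂ × ℂ)) : Set (MatOp U) :=
  {T | ∀ a b, T a b ∈ diffOps U Set.univ}

/-- The parameter `p_j` of the two summands: `p - 1` for the first, `p` for the second. -/
def width (p : ℕ) : Fin 2 → ℕ := ![p - 1, p]

/-- The direct sum of the staircase modules with parameters `(p - 1, q)` and `(p, q)`. -/
def stairModule (U : Opens (ℂ × ℂ)) (r p q : ℕ) : Set (Fin 2 → SmoothFn U) :=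
  {v | ∀ b, v b ∈ scalarModule U r (width p b) q}

/-- The matrix differential operators that preserve the direct sum module. -/
def preserving (U : Opens (ℂ × ℂ)) (r p q : ℕ) : Set (MatOp U) :=
  {T | T ∈ matDiffOps U ∧ ∀ v ∈ stairModule U r p q, act T v ∈ stairModule U r p q}

/-- The kernel of the restriction map from the module-preserving operators to the endomorphisms
of the module. -/
def kernel (U : Opens (ℂ × ℂ)) (r p q : ℕ) : Set (MatOp U) :=
  {T | T ∈ preserving U r p q ∧ ∀ v ∈ stairModule U r p q, act T v = 0}

/-- The distinguished complement to the kernel: the module-preserving operators whose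
entry `T_{ab}` involves only the derivatives `∂_x^s ∂_y^t` with `s + r t ≤ p_b`, `t ≤ q`. -/
def complement (U : Opens (ℂ × ℂ)) (r p q : ℕ) : Set (MatOp U) :=
  {T | T ∈ preserving U r p q ∧ ∀ a b, T a b ∈ diffOps U (stairs r (width p b) q)}

/-- The operator has nonpositive `y`-degree: each entry maps every monomial `x^i y^j`
to a polynomial all of whose monomials `x^{i'} y^{j'}` have `j' ≤ j`. -/
def YDegNonpos (T : MatOp U) : Prop :=
  ∀ a b, ∀ i j : ℕ,
    T a b (mono U i j) ∈ Submodule.span ℂ {g | ∃ i' j' : ℕ, j' ≤ j ∧ g = mono U i' j'}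

/-- The part of the distinguished complement of nonpositive `y`-degree. -/
def complementDown (U : Opens (ℂ × ℂ)) (r p q : ℕ) : Set (MatOp U) :=
  {T | T ∈ complement U r p q ∧ YDegNonpos T}

/-- The matrix differential operators of order at most `k`. -/
def orderLE (U : Opens (ℂ × ℂ)) (k : ℕ) : Set (MatOp U) :=
  {T | ∀ a b, T a b ∈ diffOps U {m | m.1 + m.2 ≤ k}}

/-- `P` is a module-preserving operator whose projection onto the distinguished complement,
along the kernel, is `T`. -/
def IsProjection (r p q : ℕ) (P T : MatOp U) : Prop :=
  P ∈ preserving U r p q ∧ T ∈ complement U r p q ∧ P - T ∈ kernel U r p q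

/-! ### The generators -/

/-- `x² ∂_x + r x y ∂_y - c x`. -/
def J2 (r : ℕ) (c : ℂ) : Op U := X ^ 2 * dx + (r : ℂ) • (X * Y * dy) - c • X

/-- `x ∂_x - c / 2`. -/
def J3 (c : ℂ) : Op U := X * dx - (c / 2) • 1

/-- Labels of the `10 + 2 r` generators of the Lie superalgebra:
`T^1, …, T^4`, `T^{5+i}` for `0 ≤ i ≤ r`, `J`, `Q^-_0`, `Q^-_1`, `Q^+_0`, `Q^+_1`, and
`Q^+_{2+α}` for `0 ≤ α ≤ r - 1`. -/
inductive Gen (r : ℕ) : Type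
  | T1 | T2 | T3 | T4
  | T5 (i : Fin (r + 1))
  | J
  | Qm0 | Qm1 | Qp0 | Qp1
  | Qp2 (α : Fin r)

/-- The generators as matrix differential operators. -/
def gen (U : Opens (ℂ × ℂ)) (r p : ℕ) : Gen r → MatOp U
  | .T1 => !![dx, 0; 0, dx]
  | .T2 => !![J2 r ((p : ℂ) - 1), 0; 0, J2 r (p : ℂ)]
  | .T3 => !![J3 ((p : ℂ) - 1), 0; 0, J3 (p : ℂ)]
  | .T4 => !![Y * dy, 0; 0, Y * dy]
  | .T5 i => !![X ^ (i : ℕ) * dy, 0; 0, X ^ (i : ℕ) * dy]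
  | .J => !![(((p : ℂ) + 1) / 2) • 1, 0; 0, ((p : ℂ) / 2) • 1]
  | .Qm0 => !![0, 0; 1, 0]
  | .Qm1 => !![0, 0; X, 0]
  | .Qp0 => !![0, X * dx + (r : ℂ) • (Y * dy) - (p : ℂ) • 1; 0, 0]
  | .Qp1 => !![0, dx; 0, 0]
  | .Qp2 α => !![0, X ^ (α : ℕ) * dy; 0, 0]

/-- The operators that are (noncommutative) polynomials of degree at most `d` in the generators:
linear combinations of products of at most `d` generators, the empty product being `1`. -/
def polysLE (U : Opens (ℂ × ℂ)) (r p d : ℕ) : Submodule ℂ (MatOp U) :=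
  Submodule.span ℂ {P | ∃ l : List (Gen r), l.length ≤ d ∧ P = (l.map (gen U r p)).prod}

end Staircase

end

/-!
Give `x ^ i * y ^ j` the weight `i + r * j`. An operator of nonpositive `y`-degree and order at most
`k` is a combination of normally ordered monomials `x ^ a * y ^ b * ∂_x ^ s * ∂_y ^ t` with `b ≤ t`
and `s + t ≤ k`. Those lowering the weight map the staircase modules into one another and are
polynomials in the generators. The others are rewritten in a Newton basis, where `x ^ a * ∂_x ^ a`
is replaced by the falling factorial of length `a` in the codegree `c - x * ∂_x - r * y * ∂_y`, with
`c` the top weight of the source module. Evaluation at the monomials of codegree `a` is triangular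
on this basis. Hence an operator preserving the module contains only Newton operators that are
bounded or annihilate the module: a bounded one shifts the weight by `m` only if `m` is balanced by
the length `a`, and it is a polynomial in the generators because `x * (c - x * ∂_x - r * y * ∂_y)`
is `-J2 r c` and `x` intertwines the codegrees with respect to `c - 1` and `c`. The odd generators
move the result to the off-diagonal entries at the cost of at most one further factor.
-/

noncomputable section

namespace Staircase

open TopologicalSpace

variable {U : Opens (ℂ × ℂ)}

/-! ### Smooth functions and the Weyl relations -/

theorem SmoothFn.ext_on {f g : SmoothFn U} (h : ∀ z ∈ U, f.1 z = g.1 z) : f = g := by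
  ext z
  by_cases hz : z ∈ U
  · exact h z hz
  · rw [f.2.2 z hz, g.2.2 z hz]

theorem mulOp_apply (f g : SmoothFn U) (z : ℂ × ℂ) : (mulOp f g).1 z = f.1 z * g.1 z := rfl

theorem derivOp_apply (v : ℂ × ℂ) (f : SmoothFn U) {z : ℂ × ℂ} (hz : z ∈ U) :
    (derivOp v f).1 z = fderiv ℂ f.1 z v :=
  Set.indicator_of_mem (s := (U : Set (ℂ × ℂ))) hz fun z => fderiv ℂ f.1 z v

theorem mono_apply (i j : ℕ) {z : ℂ × ℂ} (hz : z ∈ U) : (mono U i j).1 z = z.1 ^ i * z.2 ^ j :=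
  Set.indicator_of_mem (s := (U : Set (ℂ × ℂ))) hz fun z => z.1 ^ i * z.2 ^ j

theorem derivOp_mono_apply (v : ℂ × ℂ) (i j : ℕ) {z : ℂ × ℂ} (hz : z ∈ U) :
    (derivOp v (mono U i j)).1 z =
      z.1 ^ i * (j * z.2 ^ (j - 1) * v.2) + z.2 ^ j * (i * z.1 ^ (i - 1) * v.1) := by
  have hmono : (mono U i j).1 =ᶠ[nhds z] fun z => z.1 ^ i * z.2 ^ j := by
    filter_upwards [U.isOpen.mem_nhds hz] with w hw using mono_apply i j hw
  have hpow : HasFDerivAt (fun z : ℂ × ℂ => z.1 ^ i * z.2 ^ j) _ z :=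
    ((hasFDerivAt_fst (𝕜 := ℂ)).pow i).mul ((hasFDerivAt_snd (𝕜 := ℂ)).pow j)
  rw [derivOp_apply _ _ hz, hmono.fderiv_eq, hpow.fderiv]
  simp

theorem dx_mono (i j : ℕ) : dx (mono U i j) = (i : ℂ) • mono U (i - 1) j := by
  refine SmoothFn.ext_on fun z hz => ?_
  rw [dx, derivOp_mono_apply _ _ _ hz]
  change _ = (i : ℂ) * (mono U (i - 1) j).1 z
  rw [mono_apply _ _ hz]
  ring

theorem dy_mono (i j : ℕ) : dy (mono U i j) = (j : ℂ) • mono U i (j - 1) := by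
  refine SmoothFn.ext_on fun z hz => ?_
  rw [dy, derivOp_mono_apply _ _ _ hz]
  change _ = (j : ℂ) * (mono U i (j - 1)).1 z
  rw [mono_apply _ _ hz]
  ring

theorem mulOp_mono_mono (a b i j : ℕ) :
    mulOp (mono U a b) (mono U i j) = mono U (a + i) (b + j) := by
  refine SmoothFn.ext_on fun z hz => ?_
  rw [mulOp_apply, mono_apply _ _ hz, mono_apply _ _ hz, mono_apply _ _ hz]
  ring

theorem mulOp_mul_mulOp (f g : SmoothFn U) : mulOp f * mulOp g = mulOp (mulOp f g) :=
  LinearMap.ext fun _ => Subtype.ext (funext fun _ => (mul_assoc _ _ _).symm)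

/-- The linear map `f ↦ mulOp f`, through which membership of `mulOp f` in a submodule can be
checked on generators. -/
def mulOpLinear (U : Opens (ℂ × ℂ)) : SmoothFn U →ₗ[ℂ] Op U where
  toFun := mulOp
  map_add' f g := by
    ext h z
    exact add_mul _ _ _
  map_smul' c f := by
    ext h z
    exact mul_assoc _ _ _

theorem derivOp_mul_mulOp (v : ℂ × ℂ) (f : SmoothFn U) :
    derivOp v * mulOp f = mulOp f * derivOp v + mulOp (derivOp v f) := by
  refine LinearMap.ext fun g => SmoothFn.ext_on fun z hz => ?_
  change (derivOp v (mulOp f g)).1 z = f.1 z * (derivOp v g).1 z + (derivOp v f).1 z * g.1 z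
  rw [derivOp_apply _ _ hz, derivOp_apply _ _ hz, derivOp_apply _ _ hz]
  change fderiv ℂ (f.1 * g.1) z v = _
  rw [fderiv_mul (differentiableAt_of_mem f hz) (differentiableAt_of_mem g hz)]
  simp [mul_comm]

theorem derivOp_derivOp_apply (v w : ℂ × ℂ) (f : SmoothFn U) {z : ℂ × ℂ} (hz : z ∈ U) :
    (derivOp v (derivOp w f)).1 z = fderiv ℂ (fderiv ℂ f.1) z v w := by
  have hderiv : (derivOp w f).1 =ᶠ[nhds z] fun z => fderiv ℂ f.1 z w := by
    filter_upwards [U.isOpen.mem_nhds hz] with y hy using derivOp_apply w f hy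
  have hdiff : DifferentiableAt ℂ (fderiv ℂ f.1) z :=
    (((contDiffOn_infty_iff_fderiv_of_isOpen U.isOpen).1 f.2.1).2.differentiableOn
      (by simp)).differentiableAt (U.isOpen.mem_nhds hz)
  rw [derivOp_apply _ _ hz, hderiv.fderiv_eq, fderiv_clm_apply hdiff (differentiableAt_const _)]
  simp

theorem commute_derivOp (v w : ℂ × ℂ) : Commute (derivOp v : Op U) (derivOp w) := by
  refine LinearMap.ext fun f => SmoothFn.ext_on fun z hz => ?_
  have hsymm : IsSymmSndFDerivAt ℂ f.1 z :=
    (f.2.1.contDiffAt (U.isOpen.mem_nhds hz)).isSymmSndFDerivAt (by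
      rw [minSmoothness_of_isRCLikeNormedField]
      exact WithTop.coe_le_coe.2 le_top)
  exact (derivOp_derivOp_apply v w f hz).trans
    ((hsymm v w).trans (derivOp_derivOp_apply w v f hz).symm)

theorem mulOp_one : mulOp (mono U 0 0) = 1 := by
  refine LinearMap.ext fun g => SmoothFn.ext_on fun z hz => ?_
  rw [mulOp_apply, mono_apply _ _ hz]
  simp

theorem mulOp_zero : mulOp (0 : SmoothFn U) = 0 := (mulOpLinear U).map_zero

theorem dx_mul_X : (dx : Op U) * X = X * dx + 1 := by
  rw [dx, X, derivOp_mul_mulOp, ← dx, dx_mono]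
  simp [mulOp_one]

theorem dy_mul_Y : (dy : Op U) * Y = Y * dy + 1 := by
  rw [dy, Y, derivOp_mul_mulOp, ← dy, dy_mono]
  simp [mulOp_one]

theorem commute_dx_Y : Commute (dx : Op U) Y := by
  rw [commute_iff_eq, dx, Y, derivOp_mul_mulOp, ← dx, dx_mono]
  simp [mulOp_zero]

theorem commute_dy_X : Commute (dy : Op U) X := by
  rw [commute_iff_eq, dy, X, derivOp_mul_mulOp, ← dy, dy_mono]
  simp [mulOp_zero]

theorem commute_X_Y : Commute (X : Op U) Y := by
  rw [commute_iff_eq, X, Y, mulOp_mul_mulOp, mulOp_mul_mulOp, mulOp_mono_mono, mulOp_mono_mono]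

theorem commute_dx_dy : Commute (dx : Op U) dy := commute_derivOp _ _

theorem X_pow (a : ℕ) : (X : Op U) ^ a = mulOp (mono U a 0) := by
  induction a with
  | zero => rw [pow_zero, mulOp_one]
  | succ a ih => rw [pow_succ, ih, X, mulOp_mul_mulOp, mulOp_mono_mono]

theorem Y_pow (b : ℕ) : (Y : Op U) ^ b = mulOp (mono U 0 b) := by
  induction b with
  | zero => rw [pow_zero, mulOp_one]
  | succ b ih => rw [pow_succ, ih, Y, mulOp_mul_mulOp, mulOp_mono_mono]

theorem mulOp_mono (a b : ℕ) : mulOp (mono U a b) = X ^ a * Y ^ b := by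
  rw [X_pow, Y_pow, mulOp_mul_mulOp, mulOp_mono_mono, add_zero, zero_add]

theorem X_pow_mono (a i j : ℕ) : ((X : Op U) ^ a) (mono U i j) = mono U (a + i) j := by
  rw [X_pow, mulOp_mono_mono, zero_add]

theorem dx_pow_mono (s i j : ℕ) :
    ((dx : Op U) ^ s) (mono U i j) = (i.descFactorial s : ℂ) • mono U (i - s) j := by
  induction s with
  | zero => simp
  | succ s ih =>
    rw [pow_succ', Module.End.mul_apply, ih, map_smul, dx_mono, smul_smul,
      Nat.descFactorial_succ, Nat.sub_sub, mul_comm, Nat.cast_mul]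

theorem dy_pow_mono (t i j : ℕ) :
    ((dy : Op U) ^ t) (mono U i j) = (j.descFactorial t : ℂ) • mono U i (j - t) := by
  induction t with
  | zero => simp
  | succ t ih =>
    rw [pow_succ', Module.End.mul_apply, ih, map_smul, dy_mono, smul_smul,
      Nat.descFactorial_succ, Nat.sub_sub, mul_comm, Nat.cast_mul]

theorem dx_pow_mul_dy_pow_mono (s t i j : ℕ) :
    (dx ^ s * dy ^ t : Op U) (mono U i j) =
      ((i.descFactorial s * j.descFactorial t : ℕ) : ℂ) • mono U (i - s) (j - t) := by
  rw [Module.End.mul_apply, dy_pow_mono, map_smul, dx_pow_mono, smul_smul, mul_comm, Nat.cast_mul]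

theorem X_mul_dx_mono (i j : ℕ) : (X * dx : Op U) (mono U i j) = (i : ℂ) • mono U i j := by
  rw [Module.End.mul_apply, dx_mono, map_smul, X, mulOp_mono_mono]
  rcases i with _ | i
  · simp
  · simp [add_comm]

theorem Y_mul_dy_mono (i j : ℕ) : (Y * dy : Op U) (mono U i j) = (j : ℂ) • mono U i j := by
  rw [Module.End.mul_apply, dy_mono, map_smul, Y, mulOp_mono_mono]
  rcases j with _ | j
  · simp
  · simp [add_comm]

theorem mono_ne_zero (hU : (U : Set (ℂ × ℂ)).Nonempty) (i j : ℕ) : mono U i j ≠ 0 := by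
  obtain ⟨z, hz⟩ := hU
  intro hzero
  have hderiv := dx_pow_mul_dy_pow_mono (U := U) i j i j
  rw [hzero, map_zero] at hderiv
  have hvalue := congrArg (fun f : SmoothFn U => f.1 z) hderiv
  change 0 = _ * (mono U (i - i) (j - j)).1 z at hvalue
  rw [mono_apply _ _ hz] at hvalue
  simp [Nat.descFactorial_self, Nat.factorial_ne_zero] at hvalue

theorem linearIndependent_mono (hU : (U : Set (ℂ × ℂ)).Nonempty) :
    LinearIndependent ℂ (fun m : ℕ × ℕ => mono U m.1 m.2) := by
  -- The monomials are eigenvectors of `x ∂_x + √-1 y ∂_y` with distinct eigenvalues.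
  refine Module.End.eigenvectors_linearIndependent' ((X : Op U) * dx + Complex.I • (Y * dy))
    (fun m : ℕ × ℕ => (m.1 : ℂ) + Complex.I * m.2) (fun m m' h => ?_) _
    fun m => ⟨?_, mono_ne_zero hU _ _⟩
  · have hre := congrArg Complex.re h
    have him := congrArg Complex.im h
    simp only [Complex.add_re, Complex.natCast_re, Complex.mul_re, Complex.I_re, zero_mul,
      Complex.I_im, Complex.natCast_im, mul_zero, sub_self, add_zero, Nat.cast_inj,
      Complex.add_im, Complex.mul_im, one_mul, zero_add] at hre him
    exact Prod.ext hre him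
  · rw [Module.End.mem_eigenspace_iff, LinearMap.add_apply, X_mul_dx_mono, LinearMap.smul_apply,
      Y_mul_dy_mono, smul_smul, add_smul]

/-! ### Normally ordered monomials -/

theorem weyl_pow_mul {A : Type*} [Semiring A] {D M : A} (h : D * M = M * D + 1) (s : ℕ) :
    D ^ s * (M * D) = M * D ^ (s + 1) + s • D ^ s := by
  induction s with
  | zero => simp
  | succ s ih =>
    calc D ^ (s + 1) * (M * D) = D * (D ^ s * (M * D)) := by rw [pow_succ', mul_assoc]
      _ = D * M * D ^ (s + 1) + s • D ^ (s + 1) := by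
        rw [ih, mul_add, mul_smul_comm, ← pow_succ', mul_assoc]
      _ = M * D ^ (s + 2) + (s + 1) • D ^ (s + 1) := by
        rw [h, add_mul, mul_assoc, ← pow_succ', one_mul, add_assoc, succ_nsmul']

theorem mulOp_mul_pow_mul_X_mul_dx (f : SmoothFn U) (s t : ℕ) :
    mulOp f * dx ^ s * dy ^ t * (X * dx) =
      mulOp (mulOp f (mono U 1 0)) * dx ^ (s + 1) * dy ^ t +
        (s : ℂ) • (mulOp f * dx ^ s * dy ^ t) := by
  have hcomm : Commute (dy ^ t : Op U) (X * dx) :=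
    (commute_dy_X.mul_right commute_dx_dy.symm).pow_left t
  rw [mul_assoc _ (dy ^ t), hcomm.eq, ← mul_assoc, mul_assoc _ (dx ^ s), weyl_pow_mul dx_mul_X,
    mul_add, ← mul_assoc, X, mulOp_mul_mulOp, mul_smul_comm, add_mul, smul_mul_assoc,
    Nat.cast_smul_eq_nsmul]

theorem mulOp_mul_pow_mul_Y_mul_dy (f : SmoothFn U) (s t : ℕ) :
    mulOp f * dx ^ s * dy ^ t * (Y * dy) =
      mulOp (mulOp f (mono U 0 1)) * dx ^ s * dy ^ (t + 1) +
        (t : ℂ) • (mulOp f * dx ^ s * dy ^ t) := by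
  have hY : mulOp f * dx ^ s * Y = mulOp (mulOp f (mono U 0 1)) * dx ^ s := by
    rw [mul_assoc, (commute_dx_Y.pow_left s).eq, ← mul_assoc, Y, mulOp_mul_mulOp]
  rw [mul_assoc _ (dy ^ t), weyl_pow_mul dy_mul_Y, mul_add, ← mul_assoc, hY, mul_smul_comm,
    Nat.cast_smul_eq_nsmul]

/-- The normally ordered operator `x^a y^b ∂_x^s ∂_y^t`. -/
def weylMono (U : Opens (ℂ × ℂ)) (a b s t : ℕ) : Op U := mulOp (mono U a b) * dx ^ s * dy ^ t

theorem weylMono_zero : weylMono U 0 0 0 0 = 1 := by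
  simp [weylMono, mulOp_one]

theorem weylMono_mono (a b s t i j : ℕ) :
    weylMono U a b s t (mono U i j) =
      ((i.descFactorial s * j.descFactorial t : ℕ) : ℂ) • mono U (a + (i - s)) (b + (j - t)) := by
  rw [weylMono, mul_assoc, Module.End.mul_apply, dx_pow_mul_dy_pow_mono, map_smul,
    mulOp_mono_mono]

theorem weylMono_mul_dx (a b s t : ℕ) : weylMono U a b s t * dx = weylMono U a b (s + 1) t := by
  rw [weylMono, weylMono, mul_assoc, ← (commute_dx_dy.pow_right t).eq, pow_succ]
  simp only [mul_assoc]

theorem weylMono_mul_X_pow (a b t m : ℕ) :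
    weylMono U a b 0 t * X ^ m = weylMono U (a + m) b 0 t := by
  rw [weylMono, weylMono, mul_assoc, (commute_dy_X.pow_pow t m).eq, mulOp_mono, mulOp_mono,
    pow_add, pow_zero]
  simp only [mul_one, mul_assoc]
  rw [← mul_assoc (Y ^ b), (commute_X_Y.pow_pow m b).symm.eq]
  simp only [mul_assoc]

theorem weylMono_mul_X_pow_mul_dy (a b t i : ℕ) :
    weylMono U a b 0 t * (X ^ i * dy) = weylMono U (a + i) b 0 (t + 1) := by
  rw [← mul_assoc, weylMono_mul_X_pow, weylMono, weylMono, mul_assoc, ← pow_succ]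

theorem weylMono_mul_X_mul_dx (a b s t : ℕ) :
    weylMono U a b s t * (X * dx) =
      weylMono U (a + 1) b (s + 1) t + (s : ℂ) • weylMono U a b s t := by
  rw [weylMono, mulOp_mul_pow_mul_X_mul_dx, mulOp_mono_mono, weylMono, add_zero]

theorem weylMono_mul_Y_mul_dy (a b s t : ℕ) :
    weylMono U a b s t * (Y * dy) =
      weylMono U a (b + 1) s (t + 1) + (t : ℂ) • weylMono U a b s t := by
  rw [weylMono, mulOp_mul_pow_mul_Y_mul_dy, mulOp_mono_mono, weylMono, add_zero]

/-! ### Falling factorials in an algebra -/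

theorem mem_of_eq_add_smul {R M : Type*} [Ring R] [AddCommMonoid M] [Module R M]
    {S : Submodule R M} {x y z : M} {c : R} (h : x = y + c • z) (hx : x ∈ S) (hz : z ∈ S) :
    y ∈ S := by
  have hy : y = x + (-c) • z := by
    rw [h, add_assoc, ← add_smul, add_neg_cancel, zero_smul, add_zero]
  exact hy ▸ S.add_mem hx (S.smul_mem _ hz)

section Falling

open Polynomial

variable {A : Type*} [Semiring A] [Algebra ℂ A]

/-- The falling factorial `V (V - 1) ⋯ (V - n + 1)` of an element of an algebra. -/
def falling (V : A) (n : ℕ) : A := aeval V (descPochhammer ℂ n)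

theorem falling_zero (V : A) : falling V 0 = 1 := by
  rw [falling, descPochhammer_zero, map_one]

theorem falling_mul_self (V : A) (n : ℕ) :
    falling V n * V = falling V (n + 1) + (n : ℂ) • falling V n := by
  have hpoly : descPochhammer ℂ n * Polynomial.X =
      descPochhammer ℂ (n + 1) + (n : ℂ) • descPochhammer ℂ n := by
    rw [descPochhammer_succ_right, smul_eq_C_mul, map_natCast]
    ring
  simpa only [falling, map_mul, map_add, map_smul, aeval_X] using congrArg (aeval V) hpoly

theorem falling_add_one (V : A) (n : ℕ) :
    falling (V + 1) (n + 1) = falling V n * (V + 1) := by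
  have hpoly : (descPochhammer ℂ (n + 1)).comp (Polynomial.X + 1) =
      descPochhammer ℂ n * (Polynomial.X + 1) := by
    rw [descPochhammer_succ_left, mul_comp, comp_assoc, mul_comm]
    simp
  simpa only [falling, aeval_comp, map_mul, map_add, map_one, aeval_X] using
    congrArg (aeval V) hpoly

theorem semiconjBy_falling {M V W : A} (h : SemiconjBy M V W) (n : ℕ) :
    SemiconjBy M (falling V n) (falling W n) := by
  suffices hpoly : ∀ f : ℂ[X], SemiconjBy M (aeval V f) (aeval W f) from hpoly _
  intro f
  induction f using Polynomial.induction_on' with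
  | add f g hf hg => simpa only [map_add] using hf.add_right hg
  | monomial n c =>
    simpa only [aeval_monomial] using
      SemiconjBy.mul_right (Algebra.commutes c M).symm (h.pow_right n)

theorem falling_mem_pow {G : Submodule ℂ A} {V : A} (hone : 1 ≤ G) (hV : V ∈ G) (n : ℕ) :
    falling V n ∈ G ^ n := by
  induction n with
  | zero => rw [falling_zero, pow_zero]; exact Submodule.one_le.1 le_rfl
  | succ n ih =>
    exact mem_of_eq_add_smul (falling_mul_self V n)
      (pow_succ G n ▸ Submodule.mul_mem_mul ih hV) (pow_le_pow_right' hone n.le_succ ih)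

end Falling

theorem falling_apply_of_apply_eq_smul {M : Type*} [AddCommGroup M] [Module ℂ M]
    {V : Module.End ℂ M} {v : M} {μ : ℂ} (h : V v = μ • v) (n : ℕ) :
    falling V n v = (descPochhammer ℂ n).eval μ • v :=
  Module.End.aeval_apply_of_mem_apply_eq_smul h

/-! ### First-order operators -/

/-- The operator `c - x ∂_x - r y ∂_y`, with eigenvalue `c - (i + r j)` on `x^i y^j`: the weighted
codegree with respect to `c`. -/
def codegree (U : Opens (ℂ × ℂ)) (r : ℕ) (c : ℂ) : Op U :=
  c • 1 - X * dx - (r : ℂ) • (Y * dy)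

theorem codegree_eq_add (r : ℕ) (c : ℂ) :
    codegree U r c = c • 1 + (-1 : ℂ) • (X * dx) + (-r : ℂ) • (Y * dy) := by
  rw [codegree]
  module

theorem codegree_mono (r : ℕ) (c : ℂ) (i j : ℕ) :
    codegree U r c (mono U i j) = (c - (i + r * j : ℕ)) • mono U i j := by
  simp only [codegree, LinearMap.sub_apply, LinearMap.smul_apply, Module.End.one_apply,
    X_mul_dx_mono, Y_mul_dy_mono, smul_smul, Nat.cast_add, Nat.cast_mul]
  module

theorem codegree_sub_one_add_one (r : ℕ) (c : ℂ) :
    codegree U r (c - 1) + 1 = codegree U r c := by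
  rw [codegree, codegree]
  module

theorem X_mul_codegree (r : ℕ) (c : ℂ) : X * codegree U r c = (-1 : ℂ) • J2 r c := by
  rw [codegree_eq_add, J2, mul_add, mul_add, mul_smul_comm, mul_smul_comm, mul_smul_comm, mul_one,
    sq, mul_assoc, mul_assoc]
  module

theorem semiconjBy_X_codegree (r : ℕ) (c : ℂ) :
    SemiconjBy X (codegree U r (c - 1)) (codegree U r c) := by
  have hX : X * dx * X = X * (X * dx) + (X : Op U) := by
    rw [mul_assoc, dx_mul_X, mul_add, mul_one]
  have hY : Y * dy * X = X * (Y * dy : Op U) := by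
    rw [mul_assoc, commute_dy_X.eq, ← mul_assoc, ← commute_X_Y.eq, mul_assoc]
  simp only [SemiconjBy, codegree_eq_add, mul_add, add_mul, mul_smul_comm, smul_mul_assoc, hX, hY,
    mul_one, one_mul]
  module

/-- The space of operators spanned by the identity and the scalar generators `J^i_c`. -/
def firstOrder (U : Opens (ℂ × ℂ)) (r : ℕ) (c : ℂ) : Submodule ℂ (Op U) :=
  Submodule.span ℂ ({1, dx, J2 r c, J3 c, Y * dy} ∪ {D | ∃ i ≤ r, D = X ^ i * dy})

section FirstOrder

variable {r : ℕ} {c : ℂ}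

theorem one_le_firstOrder : 1 ≤ firstOrder U r c :=
  Submodule.one_le.2 (Submodule.subset_span (by simp))

theorem firstOrder_pow_mono {m n : ℕ} (h : m ≤ n) : firstOrder U r c ^ m ≤ firstOrder U r c ^ n :=
  pow_le_pow_right' one_le_firstOrder h

theorem mul_mem_firstOrder_pow {D E : Op U} {n : ℕ} (hD : D ∈ firstOrder U r c ^ n)
    (hE : E ∈ firstOrder U r c) : D * E ∈ firstOrder U r c ^ (n + 1) :=
  pow_succ (firstOrder U r c) n ▸ Submodule.mul_mem_mul hD hE

theorem dx_mem_firstOrder : dx ∈ firstOrder U r c := Submodule.subset_span (by simp)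

theorem Y_mul_dy_mem_firstOrder : Y * dy ∈ firstOrder U r c := Submodule.subset_span (by simp)

theorem X_pow_mul_dy_mem_firstOrder {i : ℕ} (hi : i ≤ r) : X ^ i * dy ∈ firstOrder U r c :=
  Submodule.subset_span (Or.inr ⟨i, hi, rfl⟩)

theorem X_mul_dx_mem_firstOrder : X * dx ∈ firstOrder U r c := by
  have h : X * dx = J3 c + (c / 2) • (1 : Op U) := by
    rw [J3]
    module
  exact h ▸ add_mem (Submodule.subset_span (by simp))
    (Submodule.smul_mem _ _ (Submodule.one_le.1 one_le_firstOrder))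

theorem codegree_mem_firstOrder (d : ℂ) : codegree U r d ∈ firstOrder U r c := by
  rw [codegree_eq_add]
  exact add_mem (add_mem (Submodule.smul_mem _ _ (Submodule.one_le.1 one_le_firstOrder))
    (Submodule.smul_mem _ _ X_mul_dx_mem_firstOrder))
    (Submodule.smul_mem _ _ Y_mul_dy_mem_firstOrder)

theorem X_mul_codegree_mem_firstOrder : X * codegree U r c ∈ firstOrder U r c := by
  rw [X_mul_codegree]
  exact Submodule.smul_mem _ _ (Submodule.subset_span (by simp))

theorem weylMono_mem_firstOrder_pow {a b s t : ℕ} (hbt : b ≤ t) (h : a + r * b ≤ s + r * t) :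
    weylMono U a b s t ∈ firstOrder U r c ^ (s + t) := by
  induction s generalizing a with
  | succ s ih =>
    rw [add_right_comm]
    cases a with
    | zero =>
      exact weylMono_mul_dx (U := U) 0 b s t ▸
        mul_mem_firstOrder_pow (ih (by have := Nat.mul_le_mul_left r hbt; omega)) dx_mem_firstOrder
    | succ a =>
      have hW : weylMono U a b s t ∈ firstOrder U r c ^ (s + t) := ih (by omega)
      exact mem_of_eq_add_smul (weylMono_mul_X_mul_dx a b s t)
        (mul_mem_firstOrder_pow hW X_mul_dx_mem_firstOrder)
        (firstOrder_pow_mono (Nat.le_succ _) hW)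
  | zero =>
    rw [zero_add] at h ⊢
    induction t generalizing a b with
    | zero =>
      obtain ⟨rfl, rfl⟩ : a = 0 ∧ b = 0 := by omega
      rw [weylMono_zero, pow_zero]
      exact Submodule.one_le.1 le_rfl
    | succ t ih =>
      rw [mul_add_one] at h
      cases b with
      | zero =>
        have hW := mul_mem_firstOrder_pow (ih (a := a - min a r) (Nat.zero_le t) (by omega))
          (X_pow_mul_dy_mem_firstOrder (min_le_right a r))
        rwa [weylMono_mul_X_pow_mul_dy, Nat.sub_add_cancel (min_le_left a r)] at hW
      | succ b =>
        have hW : weylMono U a b 0 t ∈ firstOrder U r c ^ t :=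
          ih (Nat.le_of_succ_le_succ hbt) (by rw [mul_add_one] at h; omega)
        exact mem_of_eq_add_smul (weylMono_mul_Y_mul_dy a b 0 t)
          (mul_mem_firstOrder_pow hW Y_mul_dy_mem_firstOrder)
          (firstOrder_pow_mono t.le_succ hW)

theorem X_pow_mul_falling_mem_firstOrder_pow {m a : ℕ} (h : m ≤ a) :
    X ^ m * falling (codegree U r c) a ∈ firstOrder U r c ^ a := by
  induction a generalizing m with
  | zero =>
    rw [Nat.le_zero.1 h, falling_zero, pow_zero, pow_zero, one_mul]
    exact Submodule.one_le.1 le_rfl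
  | succ a ih =>
    rcases h.lt_or_eq with hlt | rfl
    · have hm := ih (Nat.le_of_lt_succ hlt)
      refine mem_of_eq_add_smul (y := X ^ m * falling (codegree U r c) (a + 1)) (c := (a : ℂ)) ?_
        (mul_mem_firstOrder_pow hm (codegree_mem_firstOrder c))
        (firstOrder_pow_mono a.le_succ hm)
      rw [mul_assoc, falling_mul_self, mul_add, mul_smul_comm]
    · have hX : X ^ (a + 1) * falling (codegree U r c) (a + 1) =
          X ^ a * falling (codegree U r c) a * (X * codegree U r c) :=
        calc X ^ (a + 1) * falling (codegree U r c) (a + 1)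
            = X ^ a * (X * falling (codegree U r (c - 1)) a) * codegree U r c := by
              rw [← codegree_sub_one_add_one, falling_add_one, pow_succ]
              simp only [mul_assoc]
          _ = X ^ a * falling (codegree U r c) a * (X * codegree U r c) := by
              rw [(semiconjBy_falling (semiconjBy_X_codegree r c) a).eq]
              simp only [mul_assoc]
      exact hX ▸ mul_mem_firstOrder_pow (ih le_rfl) X_mul_codegree_mem_firstOrder

end FirstOrder

/-! ### Newton operators -/

/-- The index of a Newton operator: it raises the weight `i + r j` of a monomial `x^i y^j` by `m`,
lowers its `y`-exponent by `d`, and its value is divisible by the falling factorials of length `a`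
in the codegree and of length `b + d` in `j`. -/
@[ext]
structure NewtonIndex where
  m : ℕ
  d : ℕ
  a : ℕ
  b : ℕ

/-- The order of the Newton operator with index `ν`. -/
def NewtonIndex.order (ν : NewtonIndex) : ℕ := ν.a + ν.b + ν.d

/-- The Newton operator with index `ν`, the analogue of a normally ordered monomial in which the
factor `x^a ∂_x^a` is replaced by a falling factorial of the codegree. -/
def newtonOp (U : Opens (ℂ × ℂ)) (r : ℕ) (c : ℂ) (ν : NewtonIndex) : Op U :=
  weylMono U (r * ν.d) ν.b 0 (ν.b + ν.d) * (X ^ ν.m * falling (codegree U r c) ν.a)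

theorem newtonOp_mono {r P i j : ℕ} (h : i + r * j ≤ P) (ν : NewtonIndex) :
    newtonOp U r P ν (mono U i j) =
      (((P - (i + r * j)).descFactorial ν.a * j.descFactorial (ν.b + ν.d) : ℕ) : ℂ) •
        mono U (r * ν.d + (ν.m + i)) (ν.b + (j - (ν.b + ν.d))) := by
  have hfalling : falling (codegree U r P) ν.a (mono U i j) =
      ((P - (i + r * j)).descFactorial ν.a : ℂ) • mono U i j := by
    rw [falling_apply_of_apply_eq_smul (codegree_mono r P i j), ← Nat.cast_sub h,
      descPochhammer_eval_eq_descFactorial]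
  rw [newtonOp, Module.End.mul_apply, Module.End.mul_apply, hfalling, map_smul, map_smul,
    X_pow_mono, weylMono_mono, Nat.descFactorial_zero, one_mul, smul_smul, Nat.cast_mul,
    Nat.sub_zero]

/-- The span of the Newton operators of order at most `n`. -/
def newtonSpan (U : Opens (ℂ × ℂ)) (r : ℕ) (c : ℂ) (n : ℕ) : Submodule ℂ (Op U) :=
  Submodule.span ℂ (newtonOp U r c '' {ν | ν.order ≤ n})

section NewtonSpan

variable {r : ℕ} {c : ℂ}

theorem newtonOp_mul_codegree (m d a b : ℕ) :
    newtonOp U r c ⟨m, d, a, b⟩ * codegree U r c =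
      newtonOp U r c ⟨m, d, a + 1, b⟩ + (a : ℂ) • newtonOp U r c ⟨m, d, a, b⟩ := by
  simp only [newtonOp, mul_assoc, falling_mul_self, mul_add, mul_smul_comm]

theorem commute_Y_mul_dy_X : Commute (Y * dy : Op U) X :=
  commute_X_Y.symm.mul_left commute_dy_X

theorem commute_Y_mul_dy_codegree : Commute (Y * dy : Op U) (codegree U r c) := by
  have hdx : Commute (Y * dy : Op U) dx := (commute_dx_Y.mul_right commute_dx_dy).symm
  rw [codegree_eq_add]
  exact (((Commute.one_right _).smul_right c).add_right
    ((commute_Y_mul_dy_X.mul_right hdx).smul_right _)).add_right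
    ((Commute.refl _).smul_right _)

theorem newtonOp_mul_Y_mul_dy (m d a b : ℕ) :
    newtonOp U r c ⟨m, d, a, b⟩ * (Y * dy) =
      newtonOp U r c ⟨m, d, a, b + 1⟩ + ((b + d : ℕ) : ℂ) • newtonOp U r c ⟨m, d, a, b⟩ := by
  have hcomm : Commute (X ^ m * falling (codegree U r c) a) (Y * dy) :=
    ((commute_Y_mul_dy_X.pow_right m).mul_right
      (semiconjBy_falling commute_Y_mul_dy_codegree a)).symm
  simp only [newtonOp]
  rw [mul_assoc, hcomm.eq, ← mul_assoc, weylMono_mul_Y_mul_dy, add_mul, smul_mul_assoc,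
    add_right_comm b d 1]

theorem newtonOp_mem_newtonSpan {n : ℕ} {ν : NewtonIndex} (h : ν.order ≤ n) :
    newtonOp U r c ν ∈ newtonSpan U r c n :=
  Submodule.subset_span ⟨ν, h, rfl⟩

theorem newtonSpan_mono {m n : ℕ} (h : m ≤ n) : newtonSpan U r c m ≤ newtonSpan U r c n :=
  Submodule.span_mono (Set.image_mono fun _ hν => le_trans hν h)

theorem newtonOp_mul_codegree_mem_newtonSpan {n : ℕ} {ν : NewtonIndex} (h : ν.order ≤ n) :
    newtonOp U r c ν * codegree U r c ∈ newtonSpan U r c (n + 1) := by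
  obtain ⟨m, d, a, b⟩ := ν
  rw [newtonOp_mul_codegree]
  refine add_mem (newtonOp_mem_newtonSpan ?_)
    (Submodule.smul_mem _ _ (newtonOp_mem_newtonSpan (Nat.le_succ_of_le h)))
  simp only [NewtonIndex.order] at h ⊢
  omega

theorem newtonOp_mul_Y_mul_dy_mem_newtonSpan {n : ℕ} {ν : NewtonIndex} (h : ν.order ≤ n) :
    newtonOp U r c ν * (Y * dy) ∈ newtonSpan U r c (n + 1) := by
  obtain ⟨m, d, a, b⟩ := ν
  rw [newtonOp_mul_Y_mul_dy]
  refine add_mem (newtonOp_mem_newtonSpan ?_)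
    (Submodule.smul_mem _ _ (newtonOp_mem_newtonSpan (Nat.le_succ_of_le h)))
  simp only [NewtonIndex.order] at h ⊢
  omega

theorem mul_X_mul_dx_mem_newtonSpan {n : ℕ} {D : Op U} (hD : D ∈ newtonSpan U r c n) :
    D * (X * dx) ∈ newtonSpan U r c (n + 1) := by
  have hle : newtonSpan U r c n ≤
      (newtonSpan U r c (n + 1)).comap (LinearMap.mulRight ℂ (X * dx)) := by
    refine Submodule.span_le.2 ?_
    rintro _ ⟨ν, hν, rfl⟩
    have hX : X * dx = c • 1 + (-1 : ℂ) • codegree U r c + (-r : ℂ) • (Y * dy) := by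
      rw [codegree]
      module
    change newtonOp U r c ν * (X * dx) ∈ newtonSpan U r c (n + 1)
    rw [hX, mul_add, mul_add, mul_smul_comm, mul_smul_comm, mul_smul_comm, mul_one]
    exact add_mem (add_mem
      (Submodule.smul_mem _ _ (newtonOp_mem_newtonSpan (Nat.le_succ_of_le hν)))
      (Submodule.smul_mem _ _ (newtonOp_mul_codegree_mem_newtonSpan hν)))
      (Submodule.smul_mem _ _ (newtonOp_mul_Y_mul_dy_mem_newtonSpan hν))
  exact hle hD

theorem weylMono_mem_newtonSpan (m d b s : ℕ) :
    weylMono U (r * d + m + s) b s (b + d) ∈ newtonSpan U r c (s + b + d) := by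
  induction s with
  | zero =>
    have hN : weylMono U (r * d + m) b 0 (b + d) = newtonOp U r c ⟨m, d, 0, b⟩ := by
      rw [newtonOp, falling_zero, mul_one, weylMono_mul_X_pow]
    rw [add_zero, hN]
    exact newtonOp_mem_newtonSpan le_rfl
  | succ s ih =>
    rw [show s + 1 + b + d = s + b + d + 1 by ring, ← add_assoc]
    exact mem_of_eq_add_smul (weylMono_mul_X_mul_dx _ b s (b + d))
      (mul_X_mul_dx_mem_newtonSpan ih) (newtonSpan_mono (Nat.le_succ _) ih)

end NewtonSpan

theorem mul_codegree_mem_diffOps {D : Op U} (hD : D ∈ diffOps U Set.univ) (r : ℕ) (c : ℂ) :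
    D * codegree U r c ∈ diffOps U Set.univ := by
  have hle : diffOps U Set.univ ≤
      (diffOps U Set.univ).comap (LinearMap.mulRight ℂ (codegree U r c)) := by
    refine Submodule.span_le.2 ?_
    rintro _ ⟨f, s, t, -, rfl⟩
    have hmem : ∀ (f : SmoothFn U) (s t : ℕ),
        mulOp f * dx ^ s * dy ^ t ∈ diffOps U Set.univ :=
      fun f s t => Submodule.subset_span ⟨f, s, t, trivial, rfl⟩
    change mulOp f * dx ^ s * dy ^ t * codegree U r c ∈ diffOps U Set.univ
    rw [codegree_eq_add, mul_add, mul_add, mul_smul_comm, mul_smul_comm, mul_smul_comm, mul_one,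
      mulOp_mul_pow_mul_X_mul_dx, mulOp_mul_pow_mul_Y_mul_dy]
    exact add_mem (add_mem (Submodule.smul_mem _ _ (hmem f s t))
      (Submodule.smul_mem _ _ (add_mem (hmem _ _ _) (Submodule.smul_mem _ _ (hmem f s t)))))
      (Submodule.smul_mem _ _ (add_mem (hmem _ _ _) (Submodule.smul_mem _ _ (hmem f s t))))
  exact hle hD

theorem newtonOp_mem_diffOps (r : ℕ) (c : ℂ) (ν : NewtonIndex) :
    newtonOp U r c ν ∈ diffOps U Set.univ := by
  obtain ⟨m, d, a, b⟩ := ν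
  induction a with
  | zero =>
    rw [newtonOp, falling_zero, mul_one, weylMono_mul_X_pow]
    exact Submodule.subset_span ⟨_, _, _, trivial, rfl⟩
  | succ a ih =>
    exact mem_of_eq_add_smul (newtonOp_mul_codegree m d a b) (mul_codegree_mem_diffOps ih r c) ih

/-! ### Operators of nonpositive `y`-degree -/

/-- The differential operator `∑ f_{st} ∂_x^s ∂_y^t` with coefficient family `f`. -/
def ofCoeff (U : Opens (ℂ × ℂ)) : (ℕ × ℕ →₀ SmoothFn U) →ₗ[ℂ] Op U :=
  Finsupp.lsum ℂ fun m =>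
    (LinearMap.mulRight ℂ (dx ^ m.1 * dy ^ m.2 : Op U)).comp (mulOpLinear U)

theorem ofCoeff_apply (f : ℕ × ℕ →₀ SmoothFn U) :
    ofCoeff U f = ∑ m ∈ f.support, mulOp (f m) * (dx ^ m.1 * dy ^ m.2) := by
  rw [ofCoeff, Finsupp.lsum_apply]
  rfl

theorem ofCoeff_mono (f : ℕ × ℕ →₀ SmoothFn U) (i j : ℕ) :
    ofCoeff U f (mono U i j) =
      ∑ m ∈ f.support, ((i.descFactorial m.1 * j.descFactorial m.2 : ℕ) : ℂ) •
        mulOp (f m) (mono U (i - m.1) (j - m.2)) := by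
  simp only [ofCoeff_apply, LinearMap.sum_apply, Module.End.mul_apply (mulOp _),
    dx_pow_mul_dy_pow_mono, map_smul]

theorem exists_ofCoeff_eq {I : Set (ℕ × ℕ)} {D : Op U} (hD : D ∈ diffOps U I) :
    ∃ f : ℕ × ℕ →₀ SmoothFn U, (∀ m ∈ f.support, m ∈ I) ∧ ofCoeff U f = D := by
  have h : diffOps U I ≤ (Finsupp.supported (SmoothFn U) ℂ I).map (ofCoeff U) := by
    refine Submodule.span_le.2 ?_
    rintro _ ⟨f, s, t, hst, rfl⟩
    refine ⟨Finsupp.single (s, t) f, Finsupp.single_mem_supported ℂ f hst, ?_⟩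
    rw [ofCoeff, Finsupp.lsum_single]
    exact (mul_assoc _ _ _).symm
  obtain ⟨f, hf, hfD⟩ := h hD
  exact ⟨f, fun m hm => hf hm, hfD⟩

/-- The polynomial functions of degree at most `t` in `y`. -/
def yPolys (U : Opens (ℂ × ℂ)) (t : ℕ) : Submodule ℂ (SmoothFn U) :=
  Submodule.span ℂ {g | ∃ i j : ℕ, j ≤ t ∧ g = mono U i j}

theorem mulOp_mono_mem_yPolys {t u : ℕ} {f : SmoothFn U} (hf : f ∈ yPolys U t) (i j : ℕ)
    (h : t + j ≤ u) : mulOp f (mono U i j) ∈ yPolys U u := by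
  have hle : yPolys U t ≤ (yPolys U u).comap
      ((LinearMap.applyₗ (mono U i j)).comp (mulOpLinear U)) := by
    refine Submodule.span_le.2 ?_
    rintro _ ⟨a, b, hb, rfl⟩
    exact Submodule.subset_span ⟨a + i, b + j, by omega, mulOp_mono_mono a b i j⟩
  exact hle hf

theorem mulOp_mono_zero (f : SmoothFn U) : mulOp f (mono U 0 0) = f :=
  SmoothFn.ext_on fun z hz => by simp [mulOp_apply, mono_apply _ _ hz]

theorem descFactorial_smul_mulOp_mono_mem_yPolys {m : ℕ × ℕ} {f : SmoothFn U} (s t : ℕ)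
    (hf : m.1 ≤ s → m.2 ≤ t → f ∈ yPolys U m.2) :
    ((s.descFactorial m.1 * t.descFactorial m.2 : ℕ) : ℂ) •
      mulOp f (mono U (s - m.1) (t - m.2)) ∈ yPolys U t := by
  rcases lt_or_ge s m.1 with hs | hs
  · simp [Nat.descFactorial_of_lt hs]
  rcases lt_or_ge t m.2 with ht | ht
  · simp [Nat.descFactorial_of_lt ht]
  exact Submodule.smul_mem _ _ (mulOp_mono_mem_yPolys (hf hs ht) _ _ (by omega))

theorem coeff_mem_yPolys {f : ℕ × ℕ →₀ SmoothFn U}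
    (hf : ∀ i j, ofCoeff U f (mono U i j) ∈ yPolys U j) (m : ℕ × ℕ) : f m ∈ yPolys U m.2 := by
  induction hn : m.1 + m.2 using Nat.strong_induction_on generalizing m with
  | _ n ih =>
    obtain ⟨s, t⟩ := m
    by_cases hm : (s, t) ∈ f.support
    swap
    · rw [Finsupp.notMem_support_iff.1 hm]
      exact zero_mem _
    have hlower : ∑ m ∈ f.support.erase (s, t),
        ((s.descFactorial m.1 * t.descFactorial m.2 : ℕ) : ℂ) •
          mulOp (f m) (mono U (s - m.1) (t - m.2)) ∈ yPolys U t := by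
      refine sum_mem fun m hm => descFactorial_smul_mulOp_mono_mem_yPolys s t fun hs ht => ?_
      have hne : ¬(m.1 = s ∧ m.2 = t) := fun h => (Finset.mem_erase.1 hm).1 (Prod.ext h.1 h.2)
      exact ih _ (by simp only at hn; omega) m rfl
    have htop := hf s t
    rw [ofCoeff_mono, ← Finset.add_sum_erase _ _ hm] at htop
    have hst := (Submodule.add_mem_iff_left _ hlower).1 htop
    have hfact : ((s.descFactorial s * t.descFactorial t : ℕ) : ℂ) ≠ 0 := by
      simp [Nat.descFactorial_self, Nat.factorial_ne_zero]
    simpa only [Nat.sub_self, mulOp_mono_zero] using (Submodule.smul_mem_iff _ hfact).1 hst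

theorem mem_span_weylMono {k : ℕ} {D : Op U} (hD : D ∈ diffOps U {m | m.1 + m.2 ≤ k})
    (hy : ∀ i j, D (mono U i j) ∈ yPolys U j) :
    D ∈ Submodule.span ℂ {E | ∃ a b s t, b ≤ t ∧ s + t ≤ k ∧ E = weylMono U a b s t} := by
  obtain ⟨f, hf, rfl⟩ := exists_ofCoeff_eq hD
  rw [ofCoeff_apply]
  refine sum_mem fun m hm => ?_
  have hle : yPolys U m.2 ≤ (Submodule.span ℂ
      {E | ∃ a b s t, b ≤ t ∧ s + t ≤ k ∧ E = weylMono U a b s t}).comap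
      ((LinearMap.mulRight ℂ (dx ^ m.1 * dy ^ m.2 : Op U)).comp (mulOpLinear U)) := by
    refine Submodule.span_le.2 ?_
    rintro _ ⟨a, b, hb, rfl⟩
    exact Submodule.subset_span ⟨a, b, m.1, m.2, hb, hf m hm, (mul_assoc _ _ _).symm⟩
  exact hle (coeff_mem_yPolys hy m)

/-! ### Operators between two staircase modules -/

section ScalarModule

variable {r P P' q : ℕ}

theorem scalarModule_le {M : Submodule ℂ (SmoothFn U)}
    (h : ∀ i j, i + r * j ≤ P → j ≤ q → mono U i j ∈ M) : scalarModule U r P q ≤ M := by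
  refine Submodule.span_le.2 ?_
  rintro _ ⟨i, j, ⟨hi, hj⟩, rfl⟩
  exact h i j hi hj

theorem mono_mem_scalarModule {i j : ℕ} (hi : i + r * j ≤ P) (hj : j ≤ q) :
    mono U i j ∈ scalarModule U r P q :=
  Submodule.subset_span ⟨i, j, ⟨hi, hj⟩, rfl⟩

/-- The span of the normally ordered operators of order at most `n` that do not raise the
`y`-exponent and strictly lower the weight `i + r j` of monomials. -/
def loweringOps (U : Opens (ℂ × ℂ)) (r n : ℕ) : Submodule ℂ (Op U) :=
  Submodule.span ℂ
    {E | ∃ a b s t, b ≤ t ∧ s + t ≤ n ∧ a + r * b < s + r * t ∧ E = weylMono U a b s t}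

theorem loweringOps_apply_mem_scalarModule {n : ℕ} (hP : P ≤ P' + 1) {D : Op U}
    (hD : D ∈ loweringOps U r n) {f : SmoothFn U} (hf : f ∈ scalarModule U r P q) :
    D f ∈ scalarModule U r P' q := by
  suffices hle : loweringOps U r n ≤ (scalarModule U r P' q).comap (LinearMap.applyₗ f) from hle hD
  refine Submodule.span_le.2 ?_
  rintro _ ⟨a, b, s, t, hbt, -, hlt, rfl⟩
  suffices hle : scalarModule U r P q ≤ (scalarModule U r P' q).comap (weylMono U a b s t) from
    hle hf
  refine scalarModule_le fun i j hi hj => ?_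
  rw [Submodule.mem_comap, weylMono_mono]
  rcases lt_or_ge i s with hs | hs
  · simp [Nat.descFactorial_of_lt hs]
  rcases lt_or_ge j t with ht | ht
  · simp [Nat.descFactorial_of_lt ht]
  have hweight : r * (b + (j - t)) + r * t = r * b + r * j := by
    rw [← mul_add, ← mul_add, show b + (j - t) + t = b + j by omega]
  exact Submodule.smul_mem _ _ (mono_mem_scalarModule (by omega) (by omega))

theorem span_weylMono_le (c : ℂ) (n : ℕ) :
    Submodule.span ℂ {E | ∃ a b s t, b ≤ t ∧ s + t ≤ n ∧ E = weylMono U a b s t} ≤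
      loweringOps U r n ⊔ newtonSpan U r c n := by
  refine Submodule.span_le.2 ?_
  rintro _ ⟨a, b, s, t, hbt, hn, rfl⟩
  obtain ⟨d, rfl⟩ := Nat.exists_eq_add_of_le hbt
  rcases lt_or_ge (a + r * b) (s + r * (b + d)) with hlt | hge
  · exact Submodule.mem_sup_left (Submodule.subset_span ⟨a, b, s, b + d, hbt, hn, hlt, rfl⟩)
  · obtain ⟨m, rfl⟩ : ∃ m, a = r * d + m + s := ⟨a - s - r * d, by rw [mul_add] at hge; omega⟩
    exact Submodule.mem_sup_right
      (newtonSpan_mono (by omega) (weylMono_mem_newtonSpan m d b s))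

/-- The span of the Newton operators of order at most `n` whose weight shift `m` is balanced by the
length `a` of the falling factorial, so that they map weight at most `P` to weight at most `P'`. -/
def boundedNewton (U : Opens (ℂ × ℂ)) (r P P' n : ℕ) : Submodule ℂ (Op U) :=
  Submodule.span ℂ (newtonOp U r P '' {ν | ν.order ≤ n ∧ ν.m + P ≤ ν.a + P'})

/-- The span of the Newton operators of order at most `n` whose falling factorials are too long to
be nonzero on any of the monomials spanning `scalarModule U r P q`. -/
def annihilatingNewton (U : Opens (ℂ × ℂ)) (r P q n : ℕ) : Submodule ℂ (Op U) :=
  Submodule.span ℂ (newtonOp U r P ''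
    {ν | ν.order ≤ n ∧ ¬(ν.a + r * (ν.b + ν.d) ≤ P ∧ ν.b + ν.d ≤ q)})

theorem annihilatingNewton_le_diffOps (n : ℕ) :
    annihilatingNewton U r P q n ≤ diffOps U Set.univ := by
  refine Submodule.span_le.2 ?_
  rintro _ ⟨ν, -, rfl⟩
  exact newtonOp_mem_diffOps r P ν

theorem annihilatingNewton_apply {n : ℕ} {D : Op U} (hD : D ∈ annihilatingNewton U r P q n)
    {f : SmoothFn U} (hf : f ∈ scalarModule U r P q) : D f = 0 := by
  suffices hle : annihilatingNewton U r P q n ≤ LinearMap.ker (LinearMap.applyₗ f) from hle hD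
  refine Submodule.span_le.2 ?_
  rintro _ ⟨ν, ⟨-, hν⟩, rfl⟩
  suffices hle : scalarModule U r P q ≤ LinearMap.ker (newtonOp U r P ν) from hle hf
  refine scalarModule_le fun i j hi hj => ?_
  rw [LinearMap.mem_ker, newtonOp_mono hi]
  rcases lt_or_ge (P - (i + r * j)) ν.a with ha | ha
  · simp [Nat.descFactorial_of_lt ha]
  rcases lt_or_ge j (ν.b + ν.d) with hb | hb
  · simp [Nat.descFactorial_of_lt hb]
  have hmul := Nat.mul_le_mul_left r hb
  exact absurd ⟨by omega, hb.trans hj⟩ hν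

theorem annihilatingNewton_eq_bot {n : ℕ} (hr : 1 ≤ r) (hq : n ≤ q) (hP : r * n ≤ P) :
    annihilatingNewton U r P q n = ⊥ := by
  rw [annihilatingNewton, Submodule.span_eq_bot]
  rintro _ ⟨ν, ⟨hn, hν⟩, rfl⟩
  simp only [NewtonIndex.order] at hn
  refine absurd ⟨?_, by omega⟩ hν
  calc ν.a + r * (ν.b + ν.d) ≤ r * (ν.a + ν.b + ν.d) := by nlinarith
    _ ≤ P := (Nat.mul_le_mul_left r hn).trans hP

theorem newtonOp_mono_of_codegree_eq {μ : NewtonIndex} (hμ : μ.a + r * (μ.b + μ.d) ≤ P)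
    (ν : NewtonIndex) :
    newtonOp U r P ν (mono U (P - (μ.a + r * (μ.b + μ.d))) (μ.b + μ.d)) =
      ((μ.a.descFactorial ν.a * (μ.b + μ.d).descFactorial (ν.b + ν.d) : ℕ) : ℂ) •
        mono U (r * ν.d + (ν.m + (P - (μ.a + r * (μ.b + μ.d)))))
          (ν.b + (μ.b + μ.d - (ν.b + ν.d))) := by
  rw [newtonOp_mono (by omega)]
  congr 4
  omega

theorem scalarModule_le_span_mono_compl {e : ℕ × ℕ} (he : P' < e.1 + r * e.2) :
    scalarModule U r P' q ≤ Submodule.span ℂ ((fun e : ℕ × ℕ => mono U e.1 e.2) '' {e}ᶜ) := by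
  refine scalarModule_le fun i j hi _ => Submodule.subset_span ⟨(i, j), ?_, rfl⟩
  rintro rfl
  exact absurd hi he.not_ge

theorem newtonOp_mono_mem_span_mono_compl {μ ν : NewtonIndex} (hμ : μ.a + r * (μ.b + μ.d) ≤ P)
    (hν : ν.a ≤ μ.a → ν.b ≤ μ.b → ν.d = μ.d → ν.m ≠ μ.m) :
    newtonOp U r P ν (mono U (P - (μ.a + r * (μ.b + μ.d))) (μ.b + μ.d)) ∈
      Submodule.span ℂ ((fun e : ℕ × ℕ => mono U e.1 e.2) ''
        {(r * μ.d + (μ.m + (P - (μ.a + r * (μ.b + μ.d)))), μ.b)}ᶜ) := by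
  rw [newtonOp_mono_of_codegree_eq hμ]
  rcases lt_or_ge μ.a ν.a with ha | ha
  · simp [Nat.descFactorial_of_lt ha]
  rcases lt_or_ge (μ.b + μ.d) (ν.b + ν.d) with hb | hb
  · simp [Nat.descFactorial_of_lt hb]
  refine Submodule.smul_mem _ _ (Submodule.subset_span ⟨(_, _), fun he => ?_, rfl⟩)
  obtain ⟨hx, hy⟩ := Prod.mk.inj he
  have hd : ν.d = μ.d := by omega
  rw [hd] at hx
  exact hν ha (by omega) hd (by omega)

theorem newtonCoeff_eq_zero (hU : (U : Set (ℂ × ℂ)).Nonempty) {l : NewtonIndex →₀ ℂ}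
    (hl : ∀ f ∈ scalarModule U r P q,
      Finsupp.linearCombination ℂ (newtonOp U r P) l f ∈ scalarModule U r P' q)
    (μ : NewtonIndex) (hP : μ.a + r * (μ.b + μ.d) ≤ P) (hq : μ.b + μ.d ≤ q)
    (hm : μ.a + P' < μ.m + P) : l μ = 0 := by
  classical
  induction hn : μ.a + μ.b using Nat.strong_induction_on generalizing μ with
  | _ n ih =>
    by_contra hlμ
    set i := P - (μ.a + r * (μ.b + μ.d)) with hi
    set e : ℕ × ℕ := (r * μ.d + (μ.m + i), μ.b) with he
    have hvalue := hl _ (mono_mem_scalarModule (r := r) (i := i) (by omega) hq)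
    -- Triangularity: only Newton operators with smaller `a` and `b` share the image monomial.
    have hlower : ∑ ν ∈ l.support.erase μ, l ν • newtonOp U r P ν (mono U i (μ.b + μ.d)) ∈
        Submodule.span ℂ ((fun e : ℕ × ℕ => mono U e.1 e.2) '' {e}ᶜ) := by
      refine sum_mem fun ν hν => ?_
      by_cases hshift : ν.a ≤ μ.a ∧ ν.b ≤ μ.b ∧ ν.d = μ.d ∧ ν.m = μ.m
      · obtain ⟨ha, hb, hd, hm'⟩ := hshift
        have hmul := Nat.mul_le_mul_left r hb
        have hne : ¬(ν.a = μ.a ∧ ν.b = μ.b) := fun h =>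
          (Finset.mem_erase.1 hν).1 (NewtonIndex.ext hm' hd h.1 h.2)
        rw [ih _ (by omega) ν (by rw [hd]; nlinarith) (by omega) (by omega) rfl, zero_smul]
        exact zero_mem _
      · exact Submodule.smul_mem _ _ (newtonOp_mono_mem_span_mono_compl hP fun ha hb hd hm' =>
          hshift ⟨ha, hb, hd, hm'⟩)
    have hweight : P' < e.1 + r * e.2 := by
      simp only [he]
      rw [mul_add] at hi hP
      omega
    have htop : l μ • newtonOp U r P μ (mono U i (μ.b + μ.d)) ∈
        Submodule.span ℂ ((fun e : ℕ × ℕ => mono U e.1 e.2) '' {e}ᶜ) := by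
      rw [Finsupp.linearCombination_apply, Finsupp.sum, LinearMap.sum_apply,
        ← Finset.add_sum_erase _ _ (Finsupp.mem_support_iff.2 hlμ)] at hvalue
      exact (Submodule.add_mem_iff_left _ hlower).1 (scalarModule_le_span_mono_compl hweight hvalue)
    rw [newtonOp_mono_of_codegree_eq hP, Nat.sub_self, smul_smul, Set.compl_eq_univ_sdiff] at htop
    have hzero := (linearIndependent_mono hU).eq_zero_of_smul_mem_span e _ htop
    simp [Nat.descFactorial_self, Nat.factorial_ne_zero, hlμ] at hzero

theorem linearCombination_newtonOp_mem (hU : (U : Set (ℂ × ℂ)).Nonempty) {n : ℕ} {D : Op U}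
    (hD : D ∈ newtonSpan U r P n)
    (hmaps : ∀ f ∈ scalarModule U r P q, D f ∈ scalarModule U r P' q) :
    D ∈ boundedNewton U r P P' n ⊔ annihilatingNewton U r P q n := by
  obtain ⟨l, hln, rfl⟩ := (Finsupp.mem_span_image_iff_linearCombination ℂ).1 hD
  rw [Finsupp.linearCombination_apply]
  refine Submodule.sum_mem _ fun ν hν => Submodule.smul_mem _ _ ?_
  have hn : ν.order ≤ n := hln hν
  by_cases hlong : ν.a + r * (ν.b + ν.d) ≤ P ∧ ν.b + ν.d ≤ q
  · refine Submodule.mem_sup_left (Submodule.subset_span ⟨ν, ⟨hn, ?_⟩, rfl⟩)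
    by_contra! hm
    exact Finsupp.mem_support_iff.1 hν (newtonCoeff_eq_zero hU hmaps ν hlong.1 hlong.2 hm)
  · exact Submodule.mem_sup_right (Submodule.subset_span ⟨ν, ⟨hn, hlong⟩, rfl⟩)

theorem mem_loweringOps_sup_newton (hU : (U : Set (ℂ × ℂ)).Nonempty) (hP : P ≤ P' + 1) {n : ℕ}
    {D : Op U} (hD : D ∈ diffOps U {m | m.1 + m.2 ≤ n})
    (hy : ∀ i j, D (mono U i j) ∈ yPolys U j)
    (hmaps : ∀ f ∈ scalarModule U r P q, D f ∈ scalarModule U r P' q) :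
    D ∈ loweringOps U r n ⊔ boundedNewton U r P P' n ⊔ annihilatingNewton U r P q n := by
  obtain ⟨L, hL, N, hN, rfl⟩ :=
    Submodule.mem_sup.1 (span_weylMono_le (r := r) P n (mem_span_weylMono hD hy))
  have hNmaps : ∀ f ∈ scalarModule U r P q, N f ∈ scalarModule U r P' q := fun f hf =>
    (Submodule.add_mem_iff_right _ (loweringOps_apply_mem_scalarModule hP hL hf)).1 (hmaps f hf)
  rw [sup_assoc]
  exact Submodule.add_mem_sup hL (linearCombination_newtonOp_mem hU hN hNmaps)

end ScalarModule

/-! ### Polynomials in the generators -/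

section Polys

variable {r p : ℕ}

theorem polysLE_mono {m n : ℕ} (h : m ≤ n) : polysLE U r p m ≤ polysLE U r p n := by
  refine Submodule.span_mono ?_
  rintro _ ⟨l, hl, rfl⟩
  exact ⟨l, hl.trans h, rfl⟩

theorem gen_mem_polysLE (g : Gen r) : gen U r p g ∈ polysLE U r p 1 :=
  Submodule.subset_span ⟨[g], le_rfl, List.prod_singleton.symm⟩

theorem one_mem_polysLE (n : ℕ) : 1 ∈ polysLE U r p n :=
  Submodule.subset_span ⟨[], n.zero_le, rfl⟩

theorem mul_mem_polysLE {m n : ℕ} {M N : MatOp U} (hM : M ∈ polysLE U r p m)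
    (hN : N ∈ polysLE U r p n) : M * N ∈ polysLE U r p (m + n) := by
  have hMN := Submodule.mul_mem_mul hM hN
  rw [polysLE, polysLE, Submodule.span_mul_span] at hMN
  refine Submodule.span_mono ?_ hMN
  rintro _ ⟨_, ⟨l, hl, rfl⟩, _, ⟨l', hl', rfl⟩, rfl⟩
  refine ⟨l ++ l', ?_, ?_⟩
  · rw [List.length_append]
    exact add_le_add hl hl'
  · rw [List.map_append, List.prod_append]

theorem natCast_width_zero (hp : 1 ≤ p) : (width p 0 : ℂ) = p - 1 := by
  simp [width, Nat.cast_sub hp]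

theorem exists_diagonal_mem_polysLE (hp : 1 ≤ p) (a : Fin 2) {D : Op U}
    (hD : D ∈ firstOrder U r (width p a)) :
    ∃ d : Fin 2 → Op U, Matrix.diagonal d ∈ polysLE U r p 1 ∧ d a = D := by
  suffices hle : firstOrder U r (width p a) ≤
      ((polysLE U r p 1).comap (Matrix.diagonalLinearMap (Fin 2) ℂ (Op U))).map
        (LinearMap.proj a) from hle hD
  have hgen : ∀ (g : Gen r) (d : Fin 2 → Op U), gen U r p g = !![d 0, 0; 0, d 1] →
      d a ∈ ((polysLE U r p 1).comap (Matrix.diagonalLinearMap (Fin 2) ℂ (Op U))).map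
        (LinearMap.proj a) := by
    refine fun g d hg => ⟨d, ?_, rfl⟩
    change Matrix.diagonal d ∈ polysLE U r p 1
    rw [Matrix.diagonal_fin_two, ← hg]
    exact gen_mem_polysLE g
  refine Submodule.span_le.2 ?_
  rintro D ((rfl | rfl | rfl | rfl | rfl) | ⟨i, hi, rfl⟩)
  · refine ⟨1, ?_, rfl⟩
    change Matrix.diagonal 1 ∈ polysLE U r p 1
    rw [Matrix.diagonal_one']
    exact one_mem_polysLE 1
  · exact hgen .T1 (fun _ => dx) rfl
  · exact hgen .T2 (fun b => J2 r (width p b)) (by simp only [natCast_width_zero hp]; rfl)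
  · exact hgen .T3 (fun b => J3 (width p b)) (by simp only [natCast_width_zero hp]; rfl)
  · exact hgen .T4 (fun _ => Y * dy) rfl
  · exact hgen (.T5 ⟨i, Nat.lt_succ_of_le hi⟩) (fun _ => X ^ i * dy) rfl

/-- The operators that, placed in the entry `(a, b)` of an otherwise zero matrix, give a polynomial
of degree at most `n` in the generators. -/
def blockPolys (U : Opens (ℂ × ℂ)) (r p : ℕ) (a b : Fin 2) (n : ℕ) : Submodule ℂ (Op U) :=
  (polysLE U r p n).comap (Matrix.singleLinearMap ℂ a b)

theorem mem_blockPolys {a b : Fin 2} {n : ℕ} {D : Op U} :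
    D ∈ blockPolys U r p a b n ↔ Matrix.single a b D ∈ polysLE U r p n := Iff.rfl

theorem blockPolys_mono {a b : Fin 2} {m n : ℕ} (h : m ≤ n) :
    blockPolys U r p a b m ≤ blockPolys U r p a b n :=
  Submodule.comap_mono (polysLE_mono h)

theorem mem_polysLE_of_forall_mem_blockPolys {n : ℕ} {P : MatOp U}
    (h : ∀ a b, P a b ∈ blockPolys U r p a b n) : P ∈ polysLE U r p n := by
  rw [Matrix.matrix_eq_sum_single P]
  exact sum_mem fun a _ => sum_mem fun b _ => h a b

theorem firstOrder_mul_mem_blockPolys (hp : 1 ≤ p) {a b : Fin 2} {n : ℕ} {D E : Op U}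
    (hD : D ∈ firstOrder U r (width p a)) (hE : E ∈ blockPolys U r p a b n) :
    D * E ∈ blockPolys U r p a b (n + 1) := by
  obtain ⟨d, hd, rfl⟩ := exists_diagonal_mem_polysLE hp a hD
  have hmul : Matrix.diagonal d * Matrix.single a b E = Matrix.single a b (d a * E) := by
    ext1 i j
    rw [Matrix.diagonal_mul, Matrix.single_apply, Matrix.single_apply]
    split_ifs with h
    · rw [h.1]
    · rw [mul_zero]
  rw [mem_blockPolys, ← hmul, add_comm]
  exact mul_mem_polysLE hd hE

theorem firstOrder_pow_mul_mem_blockPolys (hp : 1 ≤ p) {a b : Fin 2} {m n : ℕ} {D E : Op U}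
    (hD : D ∈ firstOrder U r (width p a) ^ n) (hE : E ∈ blockPolys U r p a b m) :
    D * E ∈ blockPolys U r p a b (n + m) := by
  induction n generalizing D with
  | zero =>
    obtain ⟨z, rfl⟩ := Submodule.mem_one.1 (pow_zero (firstOrder U r (width p a : ℂ)) ▸ hD)
    rw [zero_add, ← Algebra.smul_def]
    exact Submodule.smul_mem _ z hE
  | succ n ih =>
    rw [pow_succ'] at hD
    induction hD using Submodule.mul_induction_on' with
    | mem_mul_mem F hF G hG =>
      rw [mul_assoc, add_right_comm]
      exact firstOrder_mul_mem_blockPolys hp hF (ih hG)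
    | add F _ G _ hF hG =>
      rw [add_mul]
      exact add_mem hF hG

theorem mem_blockPolys_of_gen_eq {a b : Fin 2} {D : Op U} (g : Gen r)
    (h : ∀ i j, gen U r p g i j = Matrix.single a b D i j) : D ∈ blockPolys U r p a b 1 :=
  mem_blockPolys.2 (Matrix.ext h ▸ gen_mem_polysLE g)

theorem one_mem_blockPolys_one_zero : 1 ∈ blockPolys U r p 1 0 1 :=
  mem_blockPolys_of_gen_eq .Qm0 (by simp [Fin.forall_fin_two, gen])

theorem X_mem_blockPolys_one_zero : X ∈ blockPolys U r p 1 0 1 :=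
  mem_blockPolys_of_gen_eq .Qm1 (by simp [Fin.forall_fin_two, gen])

theorem dx_mem_blockPolys_zero_one : dx ∈ blockPolys U r p 0 1 1 :=
  mem_blockPolys_of_gen_eq .Qp1 (by simp [Fin.forall_fin_two, gen])

theorem X_pow_mul_dy_mem_blockPolys_zero_one {i : ℕ} (hi : i < r) :
    X ^ i * dy ∈ blockPolys U r p 0 1 1 :=
  mem_blockPolys_of_gen_eq (.Qp2 ⟨i, hi⟩) (by simp [Fin.forall_fin_two, gen])

theorem codegree_mem_blockPolys_zero_one : codegree U r p ∈ blockPolys U r p 0 1 1 := by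
  have hQ : X * dx + (r : ℂ) • (Y * dy) - (p : ℂ) • 1 ∈ blockPolys U r p 0 1 1 :=
    mem_blockPolys_of_gen_eq .Qp0 (by simp [Fin.forall_fin_two, gen])
  have hneg : codegree U r p = (-1 : ℂ) • (X * dx + (r : ℂ) • (Y * dy) - (p : ℂ) • 1) := by
    rw [codegree]
    module
  exact hneg ▸ Submodule.smul_mem _ _ hQ

theorem one_mem_blockPolys_self (a : Fin 2) : 1 ∈ blockPolys U r p a a 1 := by
  -- `1` and `J` span the constant diagonal matrices: `2 J - p = diag(1, 0)`.
  have hJ : ∀ s c : ℂ, s • gen U r p .J + c • (1 : MatOp U) ∈ polysLE U r p 1 := fun s c =>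
    add_mem (Submodule.smul_mem _ _ (gen_mem_polysLE .J))
      (Submodule.smul_mem _ _ (one_mem_polysLE 1))
  rw [mem_blockPolys]
  fin_cases a
  · convert hJ 2 (-p) using 1
    ext1 i j
    fin_cases i <;> fin_cases j <;> simp [gen] <;> module
  · convert hJ (-2) (p + 1) using 1
    ext1 i j
    fin_cases i <;> fin_cases j <;> simp [gen] <;> module

theorem weylMono_mem_blockPolys_zero_one (hp : 1 ≤ p) {a b s t : ℕ} (hbt : b ≤ t)
    (hlt : a + r * b < s + r * t) : weylMono U a b s t ∈ blockPolys U r p 0 1 (s + t) := by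
  cases s with
  | succ s =>
    rw [← weylMono_mul_dx, add_right_comm]
    exact firstOrder_pow_mul_mem_blockPolys hp (weylMono_mem_firstOrder_pow hbt (by omega))
      dx_mem_blockPolys_zero_one
  | zero =>
    have hb : b < t := Nat.lt_of_mul_lt_mul_left (a := r) (by omega)
    obtain ⟨t, rfl⟩ := Nat.exists_eq_add_one_of_ne_zero (Nat.ne_zero_of_lt hb)
    have hr : 0 < r := Nat.pos_of_ne_zero (by rintro rfl; omega)
    rw [mul_add_one] at hlt
    have hmul := Nat.mul_le_mul_left r (Nat.le_of_lt_add_one hb)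
    have hW := firstOrder_pow_mul_mem_blockPolys hp
      (weylMono_mem_firstOrder_pow (U := U) (r := r) (a := a - min a (r - 1)) (s := 0)
        (Nat.le_of_lt_add_one hb) (by omega))
      (X_pow_mul_dy_mem_blockPolys_zero_one (i := min a (r - 1)) (by omega))
    rwa [weylMono_mul_X_pow_mul_dy, Nat.sub_add_cancel (min_le_left a _), add_assoc] at hW

theorem weylMono_mem_blockPolys (hp : 1 ≤ p) (i j : Fin 2) {a b s t : ℕ} (hbt : b ≤ t)
    (hlt : a + r * b < s + r * t) : weylMono U a b s t ∈ blockPolys U r p i j (s + t + 1) := by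
  have hW : ∀ i, weylMono U a b s t ∈ firstOrder U r (width p i) ^ (s + t) :=
    fun i => weylMono_mem_firstOrder_pow hbt hlt.le
  match i, j with
  | 0, 0 =>
    exact mul_one (weylMono U a b s t) ▸
      firstOrder_pow_mul_mem_blockPolys hp (hW 0) (one_mem_blockPolys_self 0)
  | 0, 1 => exact blockPolys_mono (Nat.le_succ _) (weylMono_mem_blockPolys_zero_one hp hbt hlt)
  | 1, 0 =>
    exact mul_one (weylMono U a b s t) ▸
      firstOrder_pow_mul_mem_blockPolys hp (hW 1) one_mem_blockPolys_one_zero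
  | 1, 1 =>
    exact mul_one (weylMono U a b s t) ▸
      firstOrder_pow_mul_mem_blockPolys hp (hW 1) (one_mem_blockPolys_self 1)

theorem X_pow_mul_falling_mem_blockPolys_one_zero (hp : 1 ≤ p) {m a : ℕ} (h : m ≤ a + 1) :
    X ^ m * falling (codegree U r (width p 0)) a ∈ blockPolys U r p 1 0 (a + 1) := by
  cases m with
  | zero =>
    rw [pow_zero, one_mul, ← mul_one (falling _ a)]
    exact firstOrder_pow_mul_mem_blockPolys hp
      (falling_mem_pow one_le_firstOrder (codegree_mem_firstOrder _) a) one_mem_blockPolys_one_zero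
  | succ m =>
    rw [natCast_width_zero hp, pow_succ, mul_assoc,
      (semiconjBy_falling (semiconjBy_X_codegree r p) a).eq, ← mul_assoc]
    exact firstOrder_pow_mul_mem_blockPolys hp
      (X_pow_mul_falling_mem_firstOrder_pow (Nat.le_of_succ_le_succ h)) X_mem_blockPolys_one_zero

theorem X_pow_mul_falling_mem_blockPolys_zero_one (hp : 1 ≤ p) {m a : ℕ} (h : m + 1 ≤ a) :
    X ^ m * falling (codegree U r (width p 1)) a ∈ blockPolys U r p 0 1 a := by
  obtain ⟨a, rfl⟩ := Nat.exists_eq_add_of_le' (Nat.le_of_add_left_le h)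
  have hfalling : falling (codegree U r (width p 1)) (a + 1) =
      falling (codegree U r (width p 0)) a * codegree U r p := by
    rw [natCast_width_zero hp, ← codegree_sub_one_add_one r (p : ℂ), ← falling_add_one,
      codegree_sub_one_add_one]
    rfl
  rw [hfalling, ← mul_assoc]
  exact firstOrder_pow_mul_mem_blockPolys hp
    (X_pow_mul_falling_mem_firstOrder_pow (Nat.le_of_succ_le_succ h))
    codegree_mem_blockPolys_zero_one

theorem X_pow_mul_falling_mem_blockPolys (hp : 1 ≤ p) (i j : Fin 2) {m a : ℕ}
    (h : m + width p j ≤ a + width p i) :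
    X ^ m * falling (codegree U r (width p j)) a ∈ blockPolys U r p i j (a + 1) := by
  have hdiag : ∀ i, m ≤ a →
      X ^ m * falling (codegree U r (width p i)) a ∈ blockPolys U r p i i (a + 1) := fun i hm =>
    mul_one (X ^ m * falling (codegree U r (width p i)) a) ▸
      firstOrder_pow_mul_mem_blockPolys hp (X_pow_mul_falling_mem_firstOrder_pow hm)
        (one_mem_blockPolys_self i)
  have h0 : width p 0 = p - 1 := rfl
  have h1 : width p 1 = p := rfl
  match i, j with
  | 0, 0 => exact hdiag 0 (by omega)
  | 0, 1 =>
    exact blockPolys_mono a.le_succ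
      (X_pow_mul_falling_mem_blockPolys_zero_one hp (by omega))
  | 1, 0 => exact X_pow_mul_falling_mem_blockPolys_one_zero hp (by omega)
  | 1, 1 => exact hdiag 1 (by omega)

theorem loweringOps_le_blockPolys (hp : 1 ≤ p) (i j : Fin 2) (n : ℕ) :
    loweringOps U r n ≤ blockPolys U r p i j (n + 1) := by
  refine Submodule.span_le.2 ?_
  rintro _ ⟨a, b, s, t, hbt, hn, hlt, rfl⟩
  exact blockPolys_mono (Nat.succ_le_succ hn) (weylMono_mem_blockPolys hp i j hbt hlt)

theorem boundedNewton_le_blockPolys (hp : 1 ≤ p) (i j : Fin 2) (n : ℕ) :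
    boundedNewton U r (width p j) (width p i) n ≤ blockPolys U r p i j (n + 1) := by
  refine Submodule.span_le.2 ?_
  rintro _ ⟨ν, ⟨hn, hshift⟩, rfl⟩
  have hweyl : weylMono U (r * ν.d) ν.b 0 (ν.b + ν.d) ∈
      firstOrder U r (width p i) ^ (0 + (ν.b + ν.d)) :=
    weylMono_mem_firstOrder_pow (Nat.le_add_right _ _) (by rw [mul_add]; omega)
  simp only [NewtonIndex.order] at hn
  exact blockPolys_mono (by omega)
    (firstOrder_pow_mul_mem_blockPolys hp hweyl (X_pow_mul_falling_mem_blockPolys hp i j hshift))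

/-! ### Matrix operators preserving the module -/

variable {q : ℕ}

theorem entry_apply_mem_scalarModule {T : MatOp U} (hT : T ∈ preserving U r p q) (a b : Fin 2)
    {f : SmoothFn U} (hf : f ∈ scalarModule U r (width p b) q) :
    T a b f ∈ scalarModule U r (width p a) q := by
  have hsingle : Pi.single b f ∈ stairModule U r p q := fun c => by
    rcases eq_or_ne c b with rfl | hc
    · rwa [Pi.single_eq_same]
    · rw [Pi.single_eq_of_ne hc]
      exact zero_mem _
  have hact : act T (Pi.single b f) a = T a b f := by
    refine (Finset.sum_eq_single b (fun c _ hc => ?_) (by simp)).trans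
      (by rw [Pi.single_eq_same])
    rw [Pi.single_eq_of_ne hc, map_zero]
  exact hact ▸ hT.2 _ hsingle a

theorem entry_mem_blockPolys_sup_annihilatingNewton (hp : 1 ≤ p) {n : ℕ} {T : MatOp U}
    (hT : T ∈ preserving U r p q) (hy : YDegNonpos T) (hn : T ∈ orderLE U n) (a b : Fin 2) :
    T a b ∈ blockPolys U r p a b (n + 1) ⊔ annihilatingNewton U r (width p b) q n := by
  rcases (U : Set (ℂ × ℂ)).eq_empty_or_nonempty with hU | hU
  · have hzero : T a b = 0 := LinearMap.ext fun _ =>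
      SmoothFn.ext_on fun z hz => absurd hz (Set.eq_empty_iff_forall_notMem.1 hU z)
    exact hzero ▸ zero_mem _
  have hwidth : ∀ a b, width p b ≤ width p a + 1 := by
    simp only [Fin.forall_fin_two, width, Matrix.cons_val_zero, Matrix.cons_val_one]
    omega
  exact sup_le_sup_right
    (sup_le (loweringOps_le_blockPolys hp a b n) (boundedNewton_le_blockPolys hp a b n)) _
    (mem_loweringOps_sup_newton hU (hwidth a b) (hn a b) (hy a b)
      fun _ hf => entry_apply_mem_scalarModule hT a b hf)

theorem act_add (S T : MatOp U) (v : Fin 2 → SmoothFn U) : act (S + T) v = act S v + act T v :=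
  funext fun _ => Finset.sum_add_distrib

theorem add_mem_preserving {S T : MatOp U} (hS : S ∈ preserving U r p q)
    (hT : T ∈ preserving U r p q) : S + T ∈ preserving U r p q := by
  refine ⟨fun a b => add_mem (hS.1 a b) (hT.1 a b), fun v hv b => ?_⟩
  rw [act_add]
  exact add_mem (hS.2 v hv b) (hT.2 v hv b)

theorem mem_kernel_of_forall_mem_annihilatingNewton {n : ℕ} {K : MatOp U}
    (hK : ∀ a b, K a b ∈ annihilatingNewton U r (width p b) q n) : K ∈ kernel U r p q := by
  have hact : ∀ v ∈ stairModule U r p q, act K v = 0 := fun v hv =>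
    funext fun a => Finset.sum_eq_zero fun b _ => annihilatingNewton_apply (hK a b) (hv b)
  exact ⟨⟨fun a b => annihilatingNewton_le_diffOps n (hK a b),
    fun v hv b => hact v hv ▸ zero_mem _⟩, hact⟩

end Polys

theorem mainTheorem8_general (U : Opens (ℂ × ℂ)) (r p q k : ℕ) (hr : 1 ≤ r) (hp : 1 ≤ p)
    (T : MatOp U) (hT : T ∈ preserving U r p q) (hy : YDegNonpos T) (hk : T ∈ orderLE U k) :
    (k ≤ q → r * k ≤ p - 1 → T ∈ polysLE U r p (k + 1)) ∧
      ∃ P ∈ polysLE U r p (k + 1), P ∈ preserving U r p q ∧ P - T ∈ kernel U r p q := by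
  choose P hP K hK hPK using fun a b => Submodule.mem_sup.1
    (entry_mem_blockPolys_sup_annihilatingNewton hp hT hy hk a b)
  refine ⟨fun hkq hkp => mem_polysLE_of_forall_mem_blockPolys fun a b => ?_, Matrix.of P,
    mem_polysLE_of_forall_mem_blockPolys hP, ?_⟩
  · have hwidth : p - 1 ≤ width p b := by
      fin_cases b
      exacts [le_rfl, Nat.sub_le p 1]
    have hKab := hK a b
    rw [annihilatingNewton_eq_bot hr hkq (hkp.trans hwidth), Submodule.mem_bot] at hKab
    rw [← hPK, hKab, add_zero]
    exact hP a b
  · have hkernel : Matrix.of P - T ∈ kernel U r p q :=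
      mem_kernel_of_forall_mem_annihilatingNewton fun a b => by
        have hneg : (Matrix.of P - T) a b = (-1 : ℂ) • K a b := by
          rw [Matrix.sub_apply, ← hPK, Matrix.of_apply]
          module
        exact hneg ▸ Submodule.smul_mem _ _ (hK a b)
    have hsum : Matrix.of P = T + (Matrix.of P - T) := by abel
    exact ⟨hsum ▸ add_mem_preserving hT hkernel.1, hkernel⟩

end Staircase

end

theorem mainTheorem8 (U : TopologicalSpace.Opens (ℂ × ℂ)) (r p q k : ℕ)
    (hr : 2 ≤ r) (hp : 1 ≤ p) (T : Staircase.MatOp U)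
    (hT : T ∈ Staircase.complementDown U r p q) (hk : T ∈ Staircase.orderLE U k) :
    (k ≤ q → r * k ≤ p - 1 → T ∈ Staircase.polysLE U r p (k + 1)) ∧
      (∃ P ∈ Staircase.polysLE U r p (k + 1), Staircase.IsProjection r p q P T) := by
  obtain ⟨hpoly, P, hP, hpres, hker⟩ :=
    Staircase.mainTheorem8_general U r p q k (one_le_two.trans hr) hp T hT.1.1 hT.2 hk
  exact ⟨hpoly, P, hP, hpres, hT.1, hker⟩
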